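/- There are absolute constants $C_1,C_2>0$ such that the following holds. Let $\mathcal S$ be a measurable space (for instance the space of triples $s=(x,y_w,y_l)$ of a prompt and two responses), $\mathbb P$ a probability measure on $\mathcal S$, $p^*,\hat p:\mathcal S\to[0,1]$ measurable (the true and the estimated preference probability), and $\ell:\mathbb R\to[0,1]$ a measurable loss (for instance the logistic function $\sigma$). Let $\mathcal F$ be a class of measurable predictors $f:\mathcal S\to\mathbb R$ (for instance margins $f(s)=r(x,y_w)-r(x,y_l)$), with induced class $$\mathcal H=\{\,s\mapsto \hat p(s)\,\ell(f(s)) : f\in\mathcal F\,\}\subset[0,1]^{\mathcal S}.$$ Assume that $\mathcal H$ is pointwise measurable, i.e. it has a countable subclass such that every $h\in\mathcal H$ is the pointwise limit of a sequence from this subclass (this is automatic if $\mathcal S$ is countable). For $\varepsilon>0$ and $n\in\mathbb N$ let $\mathcal N_\infty(\varepsilon,\mathcal H,n)$ be the supremum over $(x_1,\dots,x_n)\in\mathcal S^n$ of the smallest cardinality of a set $A_0\subseteq A:=\{(h(x_1),\dots,h(x_n)):h\in\mathcal H\}\subset\mathbb R^n$ such that every point of $A$ is at $\|\cdot\|_\infty$-distance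 less than $\varepsilon$ from a point of $A_0$. Let $N\ge 1$, and let $\mathcal M_N=\mathcal N_\infty(1/N,\mathcal H,2N)$ be finite. For $f\in\mathcal F$ and $S=(s_1,\dots,s_N)\in\mathcal S^N$ put $$R(f)=\mathbb E_{s\sim\mathbb P}[p^*(s)\,\ell(f(s))],\qquad \hat R(f;S)=\frac1N\sum_{n=1}^N \ell(f(s_n)),\qquad \tilde R(f;S)=\frac1N\sum_{n=1}^N \hat p(s_n)\,\ell(f(s_n)),$$ and let $\tilde{\mathbb V}_N(f)$ be the empirical variance (with normalisation $1/N$) of the loss values $\hat p(s_n)\,\ell(f(s_n))$, $n=1,\dots,N$. Then for every $\delta\in(0,1)$, with probability at least $1-\delta$ over $S\sim\mathbb P^N$, simultaneously for all $f\in\mathcal F$, $$R(f)\le \tilde R(f;S)+C_1\,\mathbb E_{s\sim\mathbb P}\|\hat p(s)-p^*(s)\|_2+C_2\left(\sqrt{\tilde{\mathbb V}_N(f)\cdot\frac{\log(10\mathcal M_N/\delta)}{N}}+\frac{\log(10\mathcal M_N/\delta)}{N}\right),$$ and the same inequality holds with $\hat R(f;S)$ in place of $\tilde R(f;S)$. (If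 $\mathcal M_N\ge 2$ or $\delta\le 1/2$, then $\log(10\mathcal M_N/\delta)\le 5\log(\mathcal M_N/\delta)$, so the factor $10$ can be absorbed into $C_2$.) -/

import Mathlib

open MeasureTheory Filter Topology

noncomputable section

/-- Covering number with centres in `A`: the smallest cardinality of a set `C ⊆ A` such that every
point of `A` is at distance less than `ε` from some point of `C`. -/
def coverNum {E : Type*} [PseudoMetricSpace E] (ε : ℝ) (A : Set E) : ℕ∞ :=
  ⨅ (C : Set E) (_ : C ⊆ A ∧ ∀ x ∈ A, ∃ y ∈ C, dist x y < ε), C.encard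

/-- Uniform covering number: the supremum over `x ∈ Xⁿ` of the covering number of
`{(h x₁, …, h xₙ) | h ∈ H} ⊆ ℝⁿ`. The metric of `Fin n → ℝ` is the sup metric. -/
def uniformCoverNum {X : Type*} (ε : ℝ) (H : Set (X → ℝ)) (n : ℕ) : ℕ∞ :=
  ⨆ x : Fin n → X, coverNum ε ((fun (h : X → ℝ) (i : Fin n) => h (x i)) '' H)

/-- Pointwise measurable class: it has a countable subclass such that every member of the class is
the pointwise limit of a sequence from that subclass. -/
def PointwiseMeasurableClass {X : Type*} (H : Set (X → ℝ)) : Prop :=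
  ∃ G : Set (X → ℝ), G ⊆ H ∧ G.Countable ∧
    ∀ h ∈ H, ∃ g : ℕ → X → ℝ, (∀ n, g n ∈ G) ∧ ∀ x, Tendsto (fun n => g n x) atTop (𝓝 (h x))

/-- The induced class of weighted losses `s ↦ p(s) ℓ(f(s))`, `f ∈ F`. -/
def inducedClass {X : Type*} (p : X → ℝ) (ℓ : ℝ → ℝ) (F : Set (X → ℝ)) : Set (X → ℝ) :=
  (fun f s => p s * ℓ (f s)) '' F

/-- Population risk `E_s [p⋆(s) ℓ(f(s))]`. -/
def risk {X : Type*} [MeasurableSpace X] (P : Measure X) (pstar : X → ℝ) (ℓ : ℝ → ℝ)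
    (f : X → ℝ) : ℝ :=
  ∫ s, pstar s * ℓ (f s) ∂P

/-- Mean of `n` real numbers. -/
def empMean {n : ℕ} (v : Fin n → ℝ) : ℝ := (∑ i, v i) / n

/-- Empirical variance of `n` real numbers, with normalisation `1 / n`. -/
def empVar {n : ℕ} (v : Fin n → ℝ) : ℝ := (∑ i, (v i - empMean v) ^ 2) / n

/-- Empirical risk `(1/n) ∑ ℓ(f(sᵢ))`. -/
def empRisk {X : Type*} {n : ℕ} (ℓ : ℝ → ℝ) (f : X → ℝ) (S : Fin n → X) : ℝ :=
  empMean fun i => ℓ (f (S i))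

/-- Distilled risk `(1/n) ∑ p(sᵢ) ℓ(f(sᵢ))`. -/
def distilledRisk {X : Type*} {n : ℕ} (p : X → ℝ) (ℓ : ℝ → ℝ) (f : X → ℝ) (S : Fin n → X) : ℝ :=
  empMean fun i => p (S i) * ℓ (f (S i))

/-- Empirical variance of the loss values `p(sᵢ) ℓ(f(sᵢ))`. -/
def lossVar {X : Type*} {n : ℕ} (p : X → ℝ) (ℓ : ℝ → ℝ) (f : X → ℝ) (S : Fin n → X) : ℝ :=
  empVar fun i => p (S i) * ℓ (f (S i))

end

/-! Since `ℓ` takes values in [0,1], replacing `pstar` by `phat` in the risk costs at most E|phat -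
pstar|, and `phat ≤ 1` puts the distilled risk below the empirical one. What remains is an empirical
Bernstein bound, uniform over the induced class H, proved by symmetrization with a ghost sample S'.
If the bound fails on S for some g, then with probability at least 1/2 over S' the mean of g on S'
exceeds its mean on S by a large Bernstein term, up to a fluctuation measured by the empirical
variance on S' itself (`half_le_measure_integral_le_empMean`). The law of (S, S') is invariant under
exchanging S i with S' i, so this event has probability at most the largest proportion of the 2^N
swaps producing it on a fixed double sample (`measure_le_of_card_swapPair_le`). On a fixed double
sample, H is replaced by a 1/N-cover of at most M points. For one point the swaps act as Rademacher
signs, and the differences of means and of variances are both sign sums, with tails exp(-L)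
(`card_exceedsBernstein_swapPair_le`). Altogether failure has probability at most 2 · M · 3 exp(-L),
which is 3δ/5 for L = log(10M/δ). -/

/-! ### Sub-Gaussian tail of sign sums, by counting -/

theorem card_signs_sum_gt_le {N : ℕ} (d : Fin N → ℝ) {t : ℝ} (ht : 0 ≤ t) :
    ((Finset.univ.filter fun ε : Fin N → Bool =>
      √(2 * t * ∑ i, d i ^ 2) < ∑ i, (if ε i then -1 else 1) * d i).card : ℝ)
      ≤ 2 ^ N * Real.exp (-t) := by
  set D := ∑ i, d i ^ 2 with hD
  have hD0 : 0 ≤ D := Finset.sum_nonneg fun i _ => sq_nonneg _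
  rcases hD0.eq_or_lt with h0 | hpos
  · have hd : ∀ i, d i = 0 := by
      intro i
      have := (Finset.sum_eq_zero_iff_of_nonneg (fun i _ => sq_nonneg (d i))).1 h0.symm i
        (Finset.mem_univ i)
      exact pow_eq_zero_iff two_ne_zero |>.1 this
    -- The inequality is strict, so no sign vector satisfies it when all `d i` vanish.
    simp only [hd, ← h0]
    simp
    positivity
  set r := √(2 * t * D) with hr
  -- Optimal Chernoff parameter: l r = 2t and l² D / 2 = t, leaving exp(t - 2t).
  set l := √(2 * t / D) with hl
  have hl0 : 0 ≤ l := Real.sqrt_nonneg _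
  have hlr : l * r = 2 * t := by
    rw [hl, hr, ← Real.sqrt_mul (by positivity)]
    have : 2 * t / D * (2 * t * D) = (2 * t) ^ 2 := by field_simp
    rw [this, Real.sqrt_sq (by positivity)]
  have hl2 : l ^ 2 * D = 2 * t := by
    rw [hl, Real.sq_sqrt (by positivity)]; field_simp
  have hmgf : ∑ ε : Fin N → Bool, Real.exp (l * ∑ i, (if ε i then -1 else 1) * d i)
      ≤ 2 ^ N * Real.exp t := by
    calc ∑ ε : Fin N → Bool, Real.exp (l * ∑ i, (if ε i then -1 else 1) * d i)
        = ∑ ε : Fin N → Bool, ∏ i, Real.exp (l * ((if ε i then -1 else 1) * d i)) := by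
          refine Finset.sum_congr rfl fun ε _ => ?_
          rw [Finset.mul_sum, Real.exp_sum]
      _ = ∏ i, ∑ b : Bool, Real.exp (l * ((if b then -1 else 1) * d i)) := by
          rw [Finset.prod_univ_sum, Fintype.piFinset_univ]
      _ ≤ ∏ i, (2 * Real.exp ((l * d i) ^ 2 / 2)) := by
          refine Finset.prod_le_prod (fun i _ => by positivity) fun i _ => ?_
          have := Real.cosh_le_exp_half_sq (l * d i)
          rw [Real.cosh_eq] at this
          simp only [Fintype.sum_bool, if_true, Bool.false_eq_true, if_false]
          rw [show l * (-1 * d i) = -(l * d i) by ring, one_mul]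
          linarith
      _ = 2 ^ N * Real.exp t := by
          rw [Finset.prod_mul_distrib, ← Real.exp_sum, ← Finset.sum_div]
          simp only [mul_pow, ← Finset.mul_sum, ← hD, hl2]
          simp
  set A := Finset.univ.filter fun ε : Fin N → Bool => r < ∑ i, (if ε i then -1 else 1) * d i
  have h1 : (A.card : ℝ) * Real.exp (2 * t) ≤ 2 ^ N * Real.exp t := by
    refine le_trans ?_ hmgf
    rw [← nsmul_eq_mul, ← Finset.sum_const]
    refine le_trans (Finset.sum_le_sum fun ε hε => ?_)
      (Finset.sum_le_sum_of_subset_of_nonneg (Finset.subset_univ A) fun _ _ _ => by positivity)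
    rw [← hlr]
    exact Real.exp_le_exp.2 (mul_le_mul_of_nonneg_left (Finset.mem_filter.1 hε).2.le hl0)
  have h2 : Real.exp (2 * t) * Real.exp (-t) = Real.exp t := by
    rw [← Real.exp_add]; congr 1; ring
  have h3 : Real.exp t * Real.exp (-t) = 1 := by
    rw [← Real.exp_add]; simp
  calc (A.card : ℝ) = A.card * Real.exp (2 * t) * (Real.exp (-t) * Real.exp (-t)) := by
        rw [mul_assoc, ← mul_assoc (Real.exp (2 * t)), h2, h3, mul_one]
    _ ≤ 2 ^ N * Real.exp t * (Real.exp (-t) * Real.exp (-t)) := by gcongr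
    _ = 2 ^ N * Real.exp (-t) := by rw [mul_assoc, ← mul_assoc (Real.exp t), h3, one_mul]

/-! ### Empirical mean and variance, and their stability under sup-norm perturbation -/

theorem empVar_nonneg {n : ℕ} (v : Fin n → ℝ) : 0 ≤ empVar v :=
  div_nonneg (Finset.sum_nonneg fun _ _ => sq_nonneg _) n.cast_nonneg

theorem sum_sub_sq_eq_empVar {n : ℕ} (hn : 0 < n) (v : Fin n → ℝ) (c : ℝ) :
    ∑ i, (v i - c) ^ 2 = n * (empVar v + (empMean v - c) ^ 2) := by
  have hn' : (n : ℝ) ≠ 0 := by positivity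
  have hs : ∑ i, v i = n * empMean v := by unfold empMean; field_simp
  have h1 : ∑ i, (v i - empMean v) ^ 2 = n * empVar v := by unfold empVar; field_simp
  rw [mul_add, ← h1]
  have e : ∀ i, (v i - c) ^ 2 = (v i - empMean v) ^ 2 + (2 * (empMean v - c) * v i
      - (empMean v - c) * (empMean v + c)) := fun i => by ring
  simp only [e, Finset.sum_add_distrib, Finset.sum_sub_distrib, ← Finset.mul_sum, hs]
  simp
  ring

theorem empMean_mem_Icc {n : ℕ} (hn : 0 < n) {v : Fin n → ℝ} (hv : ∀ i, v i ∈ Set.Icc (0 : ℝ) 1) :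
    empMean v ∈ Set.Icc (0 : ℝ) 1 := by
  have hn' : (0 : ℝ) < n := by positivity
  refine ⟨div_nonneg (Finset.sum_nonneg fun i _ => (hv i).1) hn'.le, ?_⟩
  rw [empMean, div_le_one hn']
  simpa using Finset.sum_le_sum fun i (_ : i ∈ Finset.univ) => (hv i).2

theorem empMean_sub_empMean_le {n : ℕ} (hn : 0 < n) {v w : Fin n → ℝ} {r : ℝ}
    (h : ∀ i, |v i - w i| ≤ r) : |empMean v - empMean w| ≤ r := by
  have hn' : (0 : ℝ) < n := by positivity
  rw [empMean, empMean, ← sub_div, ← Finset.sum_sub_distrib, abs_div, abs_of_pos hn',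
    div_le_iff₀ hn']
  refine (Finset.abs_sum_le_sum_abs _ _).trans ?_
  simpa [mul_comm] using Finset.sum_le_sum fun i (_ : i ∈ Finset.univ) => h i

theorem empVar_le_of_abs_sub_le {n : ℕ} (hn : 0 < n) {v w : Fin n → ℝ} {r : ℝ}
    (h : ∀ i, |v i - w i| ≤ r) : empVar v ≤ 2 * empVar w + 2 * r ^ 2 := by
  have hn' : (0 : ℝ) < n := by positivity
  have h1 := sum_sub_sq_eq_empVar hn v (empMean w)
  have h2 := sum_sub_sq_eq_empVar hn w (empMean w)
  have h3 : ∑ i, (v i - empMean w) ^ 2 ≤ ∑ i, (2 * (w i - empMean w) ^ 2 + 2 * r ^ 2) := by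
    refine Finset.sum_le_sum fun i _ => ?_
    have : (v i - w i) ^ 2 ≤ r ^ 2 := sq_le_sq' (abs_le.1 (h i)).1 (abs_le.1 (h i)).2
    nlinarith [sq_nonneg (v i - w i - (w i - empMean w))]
  rw [h1, Finset.sum_add_distrib, ← Finset.mul_sum, h2] at h3
  simp at h3
  have h4 : (n : ℝ) * empVar v ≤ n * (2 * empVar w + 2 * r ^ 2) := by
    nlinarith [sq_nonneg (empMean v - empMean w)]
  exact le_of_mul_le_mul_left h4 hn'

/-! ### Bernstein deviation under random swaps of a fixed double sample -/

/-- Exchange the two entries of the pairs marked by `ε`. -/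
def swapPair {α : Type*} {N : ℕ} (ε : Fin N → Bool) (v : Fin N → α × α) : Fin N → α × α :=
  fun i => if ε i then (v i).swap else v i

/-- The mean of the second entries exceeds that of the first entries by a large multiple of the
empirical Bernstein term. -/
def ExceedsBernstein {N : ℕ} (τ : ℝ) (v : Fin N → ℝ × ℝ) : Prop :=
  37 * √(empVar (fun i => (v i).1) * τ) + 37 * τ <
    empMean (fun i => (v i).2) - empMean (fun i => (v i).1)
      + 8 * √(empVar (fun i => (v i).2) * τ) + 17 * τ

/-- Here x is the difference of the two means. As τ ≤ 1/8, the x² inside u is absorbed on the left.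
With s = √(Vτ) this gives x ≤ 6s + 4τ and √(V'τ) ≤ 3s + 2τ, and 37 = 4 + 8·2 + 17 is the resulting
coefficient of τ. -/
theorem bernstein_of_two_sample_bounds {x V V' τ u : ℝ} (hV : 0 ≤ V) (hV' : 0 ≤ V') (hτ : 0 ≤ τ)
    (hτ8 : τ ≤ 1 / 8) (hu : u = V + V' + x ^ 2 / 2) (hx : x ^ 2 ≤ 4 * τ * u)
    (hd : V' ≤ V + √(2 * τ * u)) :
    x + 8 * √(V' * τ) + 17 * τ ≤ 37 * √(V * τ) + 37 * τ := by
  have hu0 : 0 ≤ u := by rw [hu]; positivity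
  have h1 : √(2 * τ * u) ≤ u / 2 + τ := by
    apply Real.sqrt_le_iff.2 ⟨by positivity, by nlinarith [sq_nonneg (u / 2 - τ)]⟩
  have h2 : u ≤ 4 * V + x ^ 2 + 2 * τ := by linarith
  have h3 : x ^ 2 ≤ 32 * τ * V + 16 * τ ^ 2 := by
    have : 4 * τ * u ≤ 4 * τ * (4 * V + x ^ 2 + 2 * τ) := by gcongr
    nlinarith [mul_nonneg (sub_nonneg.2 hτ8) (sq_nonneg x)]
  have h4 : V' ≤ 8 * V + 4 * τ := by
    nlinarith [sq_nonneg x, mul_nonneg (sub_nonneg.2 hτ8) hV, mul_nonneg (sub_nonneg.2 hτ8) hτ]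
  set s := √(V * τ)
  have hs0 : 0 ≤ s := Real.sqrt_nonneg _
  have hs : s ^ 2 = V * τ := Real.sq_sqrt (by positivity)
  have h5 : x ≤ 6 * s + 4 * τ := by
    refine (le_abs_self x).trans (abs_le_of_sq_le_sq ?_ (by positivity))
    nlinarith [mul_nonneg hs0 hτ]
  have h6 : √(V' * τ) ≤ 3 * s + 2 * τ := by
    apply Real.sqrt_le_iff.2 ⟨by positivity, ?_⟩
    nlinarith [mul_nonneg hs0 hτ, mul_le_mul_of_nonneg_right h4 hτ]
  linarith

-- Both halves are centred at the pooled mean m, which swaps leave unchanged. The two second moments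
-- about m then add up to the swap-invariant N u, and their difference N (V' - V) is a sign sum.
-- Outside three sign tail events, |a' - a| and V' - V are therefore controlled by u.
set_option maxHeartbeats 800000 in
theorem card_exceedsBernstein_swapPair_le {N : ℕ} (hN : 0 < N) {L : ℝ} (hL : 0 ≤ L)
    (hLN : L / N ≤ 1 / 8) (c : Fin N → ℝ × ℝ)
    (hc : ∀ i, (c i).1 ∈ Set.Icc (0 : ℝ) 1 ∧ (c i).2 ∈ Set.Icc (0 : ℝ) 1) :
    (Nat.card {ε : Fin N → Bool // ExceedsBernstein (L / N) (swapPair ε c)} : ℝ)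
      ≤ 3 * (2 ^ N * Real.exp (-L)) := by
  classical
  have hN' : (0 : ℝ) < N := by positivity
  set τ := L / N with hτ
  have hLτ : L = N * τ := by rw [hτ]; field_simp
  have hτ0 : 0 ≤ τ := by positivity
  set m := (empMean (fun i => (c i).1) + empMean (fun i => (c i).2)) / 2 with hm
  have hm01 : m ∈ Set.Icc (0 : ℝ) 1 := by
    have h1 := empMean_mem_Icc hN fun i => (hc i).1
    have h2 := empMean_mem_Icc hN fun i => (hc i).2
    constructor <;> [linarith [h1.1, h2.1]; linarith [h1.2, h2.2]]
  let bad (d : Fin N → ℝ) := Finset.univ.filter fun ε : Fin N → Bool =>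
    √(2 * L * ∑ i, d i ^ 2) < ∑ i, (if ε i then -1 else 1) * d i
  let d₁ : Fin N → ℝ := fun i => (c i).2 - (c i).1
  let d₃ : Fin N → ℝ := fun i => ((c i).2 - m) ^ 2 - ((c i).1 - m) ^ 2
  have key : ∀ ε : Fin N → Bool, ExceedsBernstein τ (swapPair ε c) →
      ε ∈ bad d₁ ∪ bad (fun i => -d₁ i) ∪ bad d₃ := by
    intro ε
    contrapose!
    intro hε
    simp only [Finset.mem_union, not_or] at hε
    simp only [bad, Finset.mem_filter, Finset.mem_univ, true_and, not_lt] at hε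
    obtain ⟨⟨h1, h2⟩, h3⟩ := hε
    set v := swapPair ε c with hv
    have hsum : empMean (fun i => (v i).1) + empMean (fun i => (v i).2) = 2 * m := by
      rw [hm]
      simp only [empMean, ← add_div, ← Finset.sum_add_distrib]
      rw [mul_div_cancel₀ _ two_ne_zero]
      congr 1
      refine Finset.sum_congr rfl fun i _ => ?_
      simp only [hv, swapPair]; split_ifs <;> simp [add_comm]
    have e1 : ∑ i, (if ε i then -1 else 1) * d₁ i
        = N * (empMean (fun i => (v i).2) - empMean (fun i => (v i).1)) := by
      rw [empMean, empMean, ← sub_div, ← Finset.sum_sub_distrib, mul_div_cancel₀ _ hN'.ne']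
      refine Finset.sum_congr rfl fun i _ => ?_
      simp only [hv, swapPair, d₁]; split_ifs <;> simp
    have e2 : ∑ i, (if ε i then -1 else 1) * -d₁ i
        = -(N * (empMean (fun i => (v i).2) - empMean (fun i => (v i).1))) := by
      rw [← e1, ← Finset.sum_neg_distrib]
      exact Finset.sum_congr rfl fun i _ => by ring
    have q1 := sum_sub_sq_eq_empVar hN (fun i => (v i).1) m
    have q2 := sum_sub_sq_eq_empVar hN (fun i => (v i).2) m
    set V := empVar fun i => (v i).1
    set V' := empVar fun i => (v i).2
    set a := empMean fun i => (v i).1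
    set a' := empMean fun i => (v i).2
    set u := V + V' + (a' - a) ^ 2 / 2 with hu
    have hV : 0 ≤ V := empVar_nonneg _
    have hV' : 0 ≤ V' := empVar_nonneg _
    have hu0 : 0 ≤ u := by positivity
    have ha : (a - m) ^ 2 = (a' - a) ^ 2 / 4 := by
      rw [show m = (a + a') / 2 by linarith]; ring
    have ha' : (a' - m) ^ 2 = (a' - a) ^ 2 / 4 := by
      rw [show m = (a + a') / 2 by linarith]; ring
    simp only [ha, ha'] at q1 q2
    have e3 : ∑ i, (if ε i then -1 else 1) * d₃ i = N * (V' - V) := by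
      rw [show N * (V' - V) = N * (V' + (a' - a) ^ 2 / 4) - N * (V + (a' - a) ^ 2 / 4) by ring,
        ← q1, ← q2, ← Finset.sum_sub_distrib]
      refine Finset.sum_congr rfl fun i _ => ?_
      simp only [hv, swapPair, d₃]; split_ifs <;> simp
    have hq : ∑ i, (((c i).1 - m) ^ 2 + ((c i).2 - m) ^ 2) = N * u := by
      rw [show N * u = N * (V + (a' - a) ^ 2 / 4) + N * (V' + (a' - a) ^ 2 / 4) by rw [hu]; ring,
        ← q1, ← q2, ← Finset.sum_add_distrib]
      refine Finset.sum_congr rfl fun i _ => ?_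
      simp only [hv, swapPair]; split_ifs <;> simp [add_comm]
    have s1 : ∑ i, d₁ i ^ 2 ≤ 2 * (N * u) := by
      rw [← hq, Finset.mul_sum]
      refine Finset.sum_le_sum fun i _ => ?_
      simp only [d₁]
      nlinarith [sq_nonneg ((c i).1 - m + ((c i).2 - m))]
    -- For A, B in [0,1], (A - B)² ≤ A + B: the range of the values reduces fourth powers to second
    -- moments.
    have s3 : ∑ i, d₃ i ^ 2 ≤ N * u := by
      rw [← hq]
      refine Finset.sum_le_sum fun i _ => ?_
      have b : ∀ y ∈ Set.Icc (0 : ℝ) 1, (y - m) ^ 2 ≤ 1 := fun y hy => by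
        rw [sq_le_one_iff_abs_le_one, abs_le]
        constructor <;> linarith [hy.1, hy.2, hm01.1, hm01.2]
      have b1 := b _ (hc i).1
      have b2 := b _ (hc i).2
      simp only [d₃]
      nlinarith [sq_nonneg ((c i).1 - m), sq_nonneg ((c i).2 - m),
        mul_nonneg (sq_nonneg ((c i).1 - m)) (sq_nonneg ((c i).2 - m))]
    have hx : (a' - a) ^ 2 ≤ 4 * τ * u := by
      have r1 : |N * (a' - a)| ≤ √(4 * τ * u * N ^ 2) := by
        have : √(2 * L * ∑ i, d₁ i ^ 2) ≤ √(4 * τ * u * N ^ 2) := by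
          apply Real.sqrt_le_sqrt
          calc 2 * L * ∑ i, d₁ i ^ 2 ≤ 2 * L * (2 * (N * u)) := by gcongr
            _ = _ := by rw [hLτ]; ring
        rw [e1] at h1
        rw [e2] at h2
        simp only [neg_sq] at h2
        exact abs_le.2 ⟨by linarith, by linarith⟩
      rw [Real.le_sqrt (abs_nonneg _) (by positivity), sq_abs, mul_pow] at r1
      exact le_of_mul_le_mul_left (by linarith) (pow_pos hN' 2)
    have hd : V' ≤ V + √(2 * τ * u) := by
      have : √(2 * L * ∑ i, d₃ i ^ 2) ≤ √(2 * τ * u) * N := by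
        rw [← Real.sqrt_sq hN'.le, ← Real.sqrt_mul (by positivity)]
        apply Real.sqrt_le_sqrt
        calc 2 * L * ∑ i, d₃ i ^ 2 ≤ 2 * L * (N * u) := by gcongr
          _ = _ := by rw [hLτ]; ring
      rw [e3] at h3
      have h4 : N * (V' - V) ≤ N * √(2 * τ * u) := by linarith
      linarith [le_of_mul_le_mul_left h4 hN']
    have := bernstein_of_two_sample_bounds hV hV' hτ0 hLN hu hx hd
    unfold ExceedsBernstein
    exact not_lt.2 this
  calc (Nat.card {ε : Fin N → Bool // ExceedsBernstein τ (swapPair ε c)} : ℝ)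
      ≤ ((bad d₁ ∪ bad (fun i => -d₁ i) ∪ bad d₃).card : ℝ) := by
        rw [Nat.card_eq_fintype_card, Fintype.card_subtype]
        exact_mod_cast Finset.card_le_card fun ε hε => key ε (Finset.mem_filter.1 hε).2
    _ ≤ (bad d₁).card + (bad (fun i => -d₁ i)).card + (bad d₃).card := by
        exact_mod_cast (Finset.card_union_le _ _).trans
          (Nat.add_le_add_right (Finset.card_union_le _ _) _)
    _ ≤ 3 * (2 ^ N * Real.exp (-L)) := by
        linarith [card_signs_sum_gt_le d₁ hL, card_signs_sum_gt_le (fun i => -d₁ i) hL,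
          card_signs_sum_gt_le d₃ hL]

/-! ### Second moments of a ghost sample -/

theorem integral_sq_sum_sub_le {X : Type*} [MeasurableSpace X] (P : Measure X)
    [IsProbabilityMeasure P] {b : X → ℝ} (hb : Measurable b) (hb1 : ∀ x, |b x| ≤ 1) (N : ℕ) :
    ∫ S, (∑ i, b (S i) - N * ∫ x, b x ∂P) ^ 2 ∂(Measure.pi fun _ : Fin N => P)
      ≤ N * ∫ x, b x ^ 2 ∂P := by
  have hLp : MemLp b 2 P := MemLp.of_bound hb.aestronglyMeasurable 1 (ae_of_all _ hb1)
  have hint : Integrable b P := hLp.integrable one_le_two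
  have h := ProbabilityTheory.variance_sum_pi (ι := Fin N) (μ := fun _ => P) (X := fun _ => b)
    fun _ => hLp
  have hmean : ∫ S, (∑ i, fun ω : Fin N → X => b (ω i)) S ∂(Measure.pi fun _ : Fin N => P)
      = N * ∫ x, b x ∂P := by
    simp only [Finset.sum_apply]
    rw [integral_finsetSum]
    · have : ∀ i : Fin N, ∫ S : Fin N → X, b (S i) ∂(Measure.pi fun _ : Fin N => P)
          = ∫ x, b x ∂P := fun i =>
        integral_comp_eval (μ := fun _ : Fin N => P) (i := i) hb.aestronglyMeasurable
      simp [this]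
    · intro i _
      exact (measurePreserving_eval (fun _ : Fin N => P) i).integrable_comp_of_integrable hint
  rw [ProbabilityTheory.variance_eq_integral (Measurable.aemeasurable (by fun_prop)), hmean] at h
  simp only [Finset.sum_apply] at h
  rw [h]
  simp only [Finset.sum_const, Finset.card_univ, Fintype.card_fin, nsmul_eq_mul]
  gcongr
  exact ProbabilityTheory.variance_le_expectation_sq hb.aestronglyMeasurable

/-- The (Q - s)² term forces s ≤ 2Q + 5, hence (N x)² ≤ 8Q + 21 with Q = N (V + x²). For N ≥ 16 the
part 8 N x² is at most half the left side, and √42 < 7. -/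
theorem sub_empMean_le_of_moment_bounds {N : ℕ} (hN : 16 ≤ N) (v : Fin N → ℝ) {μ s : ℝ}
    (hs : 0 ≤ s)
    (h : (∑ i, (v i - μ)) ^ 2 + (∑ i, (v i - μ) ^ 2 - s) ^ 2 ≤ 4 * s + 1) :
    μ ≤ empMean v + 4 * √(empVar v / N) + 7 / N := by
  have hN' : (16 : ℝ) ≤ N := by exact_mod_cast hN
  have hV := empVar_nonneg v
  set V := empVar v
  set Q := ∑ i, (v i - μ) ^ 2 with hQ
  have hT : ∑ i, (v i - μ) = N * (empMean v - μ) := by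
    rw [Finset.sum_sub_distrib, empMean]
    simp
    field_simp
  have hQV := sum_sub_sq_eq_empVar (by lia) v μ
  rw [← hQ] at hQV
  rw [hT] at h
  set x := empMean v - μ with hx
  have h1 : s / 2 - 5 / 2 ≤ Q := by
    by_contra! hlt
    nlinarith [sq_nonneg (N * x), sq_nonneg (s - 3)]
  have h2 : (N * x) ^ 2 ≤ 8 * Q + 21 := by nlinarith [sq_nonneg (Q - s)]
  have h3 : (N * x) ^ 2 ≤ 16 * (N * V) + 42 := by
    have : 16 * (N * x ^ 2) ≤ N * (N * x ^ 2) := by gcongr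
    nlinarith
  have h4 : |x| ≤ 4 * √(V / N) + 7 / N := by
    apply abs_le_of_sq_le_sq _ (by positivity)
    have e : √(V / N) ^ 2 = V / N := Real.sq_sqrt (by positivity)
    have h5 : x ^ 2 ≤ 16 * (V / N) + 42 / N ^ 2 := by
      have : 16 * (V / N) + 42 / N ^ 2 = (16 * (N * V) + 42) / (N : ℝ) ^ 2 := by field_simp
      rw [this, le_div_iff₀ (by positivity)]
      linarith [mul_pow (N : ℝ) x 2]
    have h6 : (42 : ℝ) / N ^ 2 ≤ (7 / N) ^ 2 := by
      rw [div_pow]; gcongr; norm_num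
    have h7 : 0 ≤ √(V / N) * (7 / N) := by positivity
    nlinarith
  linarith [neg_abs_le x]

/-- T² and (Q - s)² each have expectation at most s = N v, the second because deviations are bounded
by 1. Markov's inequality at level 4s + 1 gives 1/2; the 1 keeps the level positive when s = 0. -/
theorem half_le_measure_integral_le_empMean {X : Type*} [MeasurableSpace X] (P : Measure X)
    [IsProbabilityMeasure P] {a : X → ℝ} (ha : Measurable a) (ha1 : ∀ x, a x ∈ Set.Icc (0 : ℝ) 1)
    {N : ℕ} (hN : 16 ≤ N) :
    (1 / 2 : ENNReal) ≤ (Measure.pi fun _ : Fin N => P) {S | ∫ x, a x ∂P ≤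
      empMean (fun i => a (S i)) + 4 * √(empVar (fun i => a (S i)) / N) + 7 / N} := by
  set π := Measure.pi fun _ : Fin N => P
  set μ := ∫ x, a x ∂P with hμ
  have hint : Integrable a P :=
    Integrable.of_bound ha.aestronglyMeasurable 1 (ae_of_all _ fun x => by
      rw [Real.norm_eq_abs, abs_of_nonneg (ha1 x).1]; exact (ha1 x).2)
  have hμ0 : 0 ≤ μ := integral_nonneg fun x => (ha1 x).1
  have hμ1 : μ ≤ 1 := by
    calc μ ≤ ∫ _, (1 : ℝ) ∂P := integral_mono hint (integrable_const _) fun x => (ha1 x).2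
      _ = 1 := by simp
  have hb : ∀ x, |a x - μ| ≤ 1 := fun x => abs_le.2
    ⟨by linarith [(ha1 x).1], by linarith [(ha1 x).2]⟩
  have hb2 : ∀ x, |(a x - μ) ^ 2| ≤ 1 := fun x => by
    rw [abs_pow]; exact pow_le_one₀ (abs_nonneg _) (hb x)
  set v := ∫ x, (a x - μ) ^ 2 ∂P with hv
  have hv0 : 0 ≤ v := integral_nonneg fun x => sq_nonneg _
  have i1 := integral_sq_sum_sub_le P (b := fun x => a x - μ) (by fun_prop) hb N
  have i2 := integral_sq_sum_sub_le P (b := fun x => (a x - μ) ^ 2) (by fun_prop) hb2 N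
  have hzero : ∫ x, (a x - μ) ∂P = 0 := by
    rw [integral_sub hint (integrable_const _)]; simp [hμ]
  simp only [hzero, mul_zero, sub_zero, ← hv] at i1 i2
  have h4 : ∫ x, ((a x - μ) ^ 2) ^ 2 ∂P ≤ v := by
    apply integral_mono_of_nonneg (ae_of_all _ fun x => by positivity)
    · exact Integrable.of_bound (Measurable.aestronglyMeasurable (by fun_prop)) 1
        (ae_of_all _ hb2)
    · refine ae_of_all _ fun x => ?_
      have := hb2 x
      rw [abs_of_nonneg (sq_nonneg _)] at this
      exact pow_le_of_le_one (sq_nonneg _) this two_ne_zero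
  set s := N * v with hs
  have hs0 : 0 ≤ s := by positivity
  set T : (Fin N → X) → ℝ := fun S => ∑ i, (a (S i) - μ)
  set Q : (Fin N → X) → ℝ := fun S => ∑ i, (a (S i) - μ) ^ 2
  have hT : Measurable T := by fun_prop
  have hQ : Measurable Q := by fun_prop
  have bT : ∀ S, |T S| ≤ N := fun S => by
    refine (Finset.abs_sum_le_sum_abs _ _).trans ?_
    simpa using Finset.sum_le_sum fun i (_ : i ∈ Finset.univ) => hb (S i)
  have bQ : ∀ S, |Q S| ≤ N := fun S => by
    refine (Finset.abs_sum_le_sum_abs _ _).trans ?_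
    simpa using Finset.sum_le_sum fun i (_ : i ∈ Finset.univ) => hb2 (S i)
  have intT : Integrable (fun S => T S ^ 2) π :=
    Integrable.of_bound (Measurable.aestronglyMeasurable (by fun_prop)) (N ^ 2)
      (ae_of_all _ fun S => by
        rw [Real.norm_eq_abs, abs_pow]; exact pow_le_pow_left₀ (abs_nonneg _) (bT S) 2)
  have intQ : Integrable (fun S => (Q S - s) ^ 2) π :=
    Integrable.of_bound (Measurable.aestronglyMeasurable (by fun_prop)) ((N + s) ^ 2)
      (ae_of_all _ fun S => by
        rw [Real.norm_eq_abs, abs_pow]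
        refine pow_le_pow_left₀ (abs_nonneg _) ((abs_sub _ _).trans ?_) 2
        rw [abs_of_nonneg hs0]
        linarith [bQ S])
  have hmarkov := mul_meas_ge_le_integral_of_nonneg (μ := π)
    (f := fun S => T S ^ 2 + (Q S - s) ^ 2) (ae_of_all _ fun S => by positivity)
    (intT.add intQ) (4 * s + 1)
  rw [integral_add intT intQ] at hmarkov
  have i2' : ∫ S, (Q S - s) ^ 2 ∂π ≤ s := i2.trans (mul_le_mul_of_nonneg_left h4 (by positivity))
  set A := {S | 4 * s + 1 ≤ T S ^ 2 + (Q S - s) ^ 2} with hA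
  have hAm : MeasurableSet A := measurableSet_le (by fun_prop) (by fun_prop)
  have hA2 : π.real A ≤ 1 / 2 := by
    have h1 : (4 * s + 1) * π.real A ≤ 2 * s := by linarith
    have h2 : 0 ≤ π.real A := measureReal_nonneg
    by_contra! hlt
    nlinarith
  have hAc : 1 / 2 ≤ π.real Aᶜ := by
    rw [probReal_compl_eq_one_sub hAm]; linarith
  have hsub : Aᶜ ⊆ {S | μ ≤
      empMean (fun i => a (S i)) + 4 * √(empVar (fun i => a (S i)) / N) + 7 / N} := fun S hS => by
    simp only [hA, Set.mem_compl_iff, Set.mem_ofPred_eq, not_le] at hS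
    exact sub_empMean_le_of_moment_bounds hN (fun i => a (S i)) hs0 hS.le
  refine le_trans ?_ (measure_mono hsub)
  rw [← ENNReal.ofReal_le_ofReal_iff measureReal_nonneg, ofReal_measureReal] at hAc
  refine le_trans (le_of_eq ?_) hAc
  rw [ENNReal.ofReal_div_of_pos two_pos]
  simp

/-! ### Symmetrization: from probabilities to counts of swaps -/

theorem measurePreserving_swapPair {X : Type*} [MeasurableSpace X] (P : Measure X)
    [IsProbabilityMeasure P] {N : ℕ} (ε : Fin N → Bool) :
    MeasurePreserving (swapPair ε) (Measure.pi fun _ : Fin N => P.prod P)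
      (Measure.pi fun _ : Fin N => P.prod P) :=
  measurePreserving_pi (f := fun i (p : X × X) => if ε i then p.swap else p) _ _ fun i => by
    cases ε i
    · exact MeasurePreserving.id _
    · exact Measure.measurePreserving_swap

/-- Every swap preserves the measure, so the measure of B is the integral over ω of the proportion
of swaps sending ω into B. -/
theorem measure_le_of_card_swapPair_le {X : Type*} [MeasurableSpace X] (P : Measure X)
    [IsProbabilityMeasure P] {N : ℕ} {B : Set (Fin N → X × X)} (hB : MeasurableSet B) {q : ℝ}
    (h : ∀ ω, (Nat.card {ε : Fin N → Bool // swapPair ε ω ∈ B} : ℝ) ≤ 2 ^ N * q) :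
    (Measure.pi fun _ : Fin N => P.prod P).real B ≤ q := by
  classical
  set π := Measure.pi fun _ : Fin N => P.prod P
  have hm : ∀ ε : Fin N → Bool, MeasurableSet (swapPair ε ⁻¹' B) := fun ε =>
    (measurePreserving_swapPair P ε).measurable hB
  have h1 : ∀ ε : Fin N → Bool,
      ∫ ω, (swapPair ε ⁻¹' B).indicator (fun _ => (1 : ℝ)) ω ∂π = π.real B := fun ε => by
    rw [integral_indicator_const _ (hm ε), measureReal_def,
      (measurePreserving_swapPair P ε).measure_preimage hB.nullMeasurableSet]
    simp [measureReal_def, π]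
  have hint : ∀ ε : Fin N → Bool,
      Integrable ((swapPair ε ⁻¹' B).indicator (fun _ => (1 : ℝ))) π := fun ε =>
    (integrable_const _).indicator (hm ε)
  have h2 : 2 ^ N * π.real B
      = ∫ ω, ∑ ε : Fin N → Bool, (swapPair ε ⁻¹' B).indicator (fun _ => (1 : ℝ)) ω ∂π := by
    rw [integral_finsetSum _ fun ε _ => hint ε]
    simp [h1]
  have h3 : ∀ ω, ∑ ε : Fin N → Bool, (swapPair ε ⁻¹' B).indicator (fun _ => (1 : ℝ)) ω
      ≤ 2 ^ N * q := fun ω => by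
    refine le_trans (le_of_eq ?_) (h ω)
    rw [Nat.card_eq_fintype_card, Fintype.card_subtype]
    simp [Set.indicator_apply]
  have h4 : 2 ^ N * π.real B ≤ 2 ^ N * q := by
    rw [h2]
    calc _ ≤ ∫ _, (2 ^ N * q : ℝ) ∂π :=
          integral_mono (integrable_finsetSum _ fun ε _ => hint ε) (integrable_const _) h3
      _ = _ := by simp [π]
  exact le_of_mul_le_mul_left h4 (by positivity)

/-! ### Discretization of the class on a double sample -/

/-- Centres are value vectors of members of H, so for a [0,1]-valued class the sign bounds apply to
them. -/
theorem exists_finset_cover_of_uniformCoverNum {X : Type*} {H : Set (X → ℝ)} {N M : ℕ} {r : ℝ}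
    (hM : uniformCoverNum r H (2 * N) = (M : ℕ∞)) (ω : Fin N → X × X) :
    ∃ C : Finset (Fin N → ℝ × ℝ), C.card ≤ M ∧
      (∀ c ∈ C, ∃ h ∈ H, c = fun i => (h (ω i).1, h (ω i).2)) ∧
      ∀ h ∈ H, ∃ c ∈ C, ∀ i, |h (ω i).1 - (c i).1| ≤ r ∧ |h (ω i).2 - (c i).2| ≤ r := by
  classical
  let e : Fin 2 × Fin N ≃ Fin (2 * N) := finProdFinEquiv
  let x : Fin (2 * N) → X := fun k =>
    if (e.symm k).1 = 0 then (ω (e.symm k).2).1 else (ω (e.symm k).2).2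
  have x0 : ∀ i, x (e (0, i)) = (ω i).1 := fun i => by simp [x]
  have x1 : ∀ i, x (e (1, i)) = (ω i).2 := fun i => by simp [x]
  -- Being strictly below M + 1 yields an actual cover from the infimum, without showing that it is
  -- attained.
  have hlt : coverNum r ((fun (h : X → ℝ) i => h (x i)) '' H) < (M : ℕ∞) + 1 := by
    refine lt_of_le_of_lt ?_ ((ENat.lt_add_one_iff (ENat.natCast_ne_top M)).2 le_rfl)
    rw [← hM, uniformCoverNum]
    exact le_iSup (fun x : Fin (2 * N) → X => coverNum r ((fun (h : X → ℝ) i => h (x i)) '' H)) x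
  simp only [coverNum, iInf_lt_iff] at hlt
  obtain ⟨C, ⟨hCA, hC⟩, hcard⟩ := hlt
  have hcard' : C.encard ≤ M := (ENat.lt_add_one_iff (ENat.natCast_ne_top M)).1 hcard
  have hfin : C.Finite := Set.finite_of_encard_le_coe hcard'
  let p : (Fin (2 * N) → ℝ) → Fin N → ℝ × ℝ := fun y i => (y (e (0, i)), y (e (1, i)))
  refine ⟨hfin.toFinset.image p, Finset.card_image_le.trans ?_, ?_, ?_⟩
  · rw [hfin.encard_eq_coe_toFinset_card] at hcard'
    exact_mod_cast hcard'
  · intro c hc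
    obtain ⟨y, hy, rfl⟩ := Finset.mem_image.1 hc
    obtain ⟨h, hh, rfl⟩ := hCA (hfin.mem_toFinset.1 hy)
    exact ⟨h, hh, by simp only [p, x0, x1]⟩
  · intro h hh
    obtain ⟨y, hy, hd⟩ := hC _ ⟨h, hh, rfl⟩
    refine ⟨p y, Finset.mem_image_of_mem _ (hfin.mem_toFinset.2 hy), fun i => ?_⟩
    have hk : ∀ k, |h (x k) - y k| ≤ r := fun k => (dist_le_pi_dist _ _ k).trans hd.le
    exact ⟨by simpa only [x0] using hk (e (0, i)), by simpa only [x1] using hk (e (1, i))⟩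

/-- The inequality that holds with positive probability over the second sample when the empirical
Bernstein bound fails for the first one. -/
def GhostExceeds {N : ℕ} (τ : ℝ) (v : Fin N → ℝ × ℝ) : Prop :=
  empMean (fun i => (v i).1) + 74 * (√(empVar (fun i => (v i).1) * τ) + τ) ≤
    empMean (fun i => (v i).2) + 4 * √(empVar (fun i => (v i).2) * τ) + 7 * τ

theorem sqrt_empVar_mul_le {N : ℕ} (hN : 0 < N) {τ r : ℝ} (hτ : 0 ≤ τ) (hτ8 : τ ≤ 1 / 8)
    (hr : 0 ≤ r) {v w : Fin N → ℝ} (h : ∀ i, |v i - w i| ≤ r) :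
    √(empVar v * τ) ≤ 2 * √(empVar w * τ) + r := by
  have h1 := mul_le_mul_of_nonneg_right (empVar_le_of_abs_sub_le hN h) hτ
  have h2 : √(empVar w * τ) ^ 2 = empVar w * τ :=
    Real.sq_sqrt (mul_nonneg (empVar_nonneg w) hτ)
  have h3 := mul_nonneg (Real.sqrt_nonneg (empVar w * τ)) hr
  apply Real.sqrt_le_iff.2 ⟨by positivity, ?_⟩
  nlinarith [mul_nonneg (sub_nonneg.2 hτ8) (sq_nonneg r)]

/-- Passing to a centre at most doubles each square root, up to r: hence 74 becomes 37 and 4 becomes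
8. The accumulated error 43 r ≤ 43τ/2 fits in the slack between the τ terms. -/
theorem exceedsBernstein_of_ghostExceeds {N : ℕ} (hN : 0 < N) {τ r : ℝ} (hτ : 0 < τ)
    (hτ8 : τ ≤ 1 / 8) (hr : 0 ≤ r) (hrτ : r ≤ τ / 2) {v c : Fin N → ℝ × ℝ}
    (h : ∀ i, |(v i).1 - (c i).1| ≤ r ∧ |(v i).2 - (c i).2| ≤ r) (hv : GhostExceeds τ v) :
    ExceedsBernstein τ c := by
  unfold GhostExceeds at hv
  unfold ExceedsBernstein
  have m1 := abs_le.1 (empMean_sub_empMean_le hN fun i => (h i).1)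
  have m2 := abs_le.1 (empMean_sub_empMean_le hN fun i => (h i).2)
  have s1 := sqrt_empVar_mul_le hN hτ.le hτ8 hr (v := fun i => (c i).1) (w := fun i => (v i).1)
    fun i => by rw [abs_sub_comm]; exact (h i).1
  have s2 := sqrt_empVar_mul_le hN hτ.le hτ8 hr (v := fun i => (v i).2) (w := fun i => (c i).2)
    fun i => (h i).2
  linarith [m1.1, m2.2]

/-! ### Measurability over a countable subclass -/

theorem measurable_empMean_comp {Y X : Type*} [MeasurableSpace X] [MeasurableSpace Y] {N : ℕ}
    {g : X → ℝ} (hg : Measurable g) {S : Y → Fin N → X} (hS : Measurable S) :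
    Measurable fun y => empMean fun i => g (S y i) := by
  unfold empMean; fun_prop

theorem measurable_empVar_comp {Y X : Type*} [MeasurableSpace X] [MeasurableSpace Y] {N : ℕ}
    {g : X → ℝ} (hg : Measurable g) {S : Y → Fin N → X} (hS : Measurable S) :
    Measurable fun y => empVar fun i => g (S y i) := by
  unfold empVar empMean; fun_prop

theorem measurableSet_forall_bernstein {X : Type*} [MeasurableSpace X] (P : Measure X) {N : ℕ}
    {G : Set (X → ℝ)} (hG : G.Countable) (hGm : ∀ g ∈ G, Measurable g) (τ : ℝ) :
    MeasurableSet {S : Fin N → X | ∀ g ∈ G, ∫ x, g x ∂P ≤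
      empMean (fun i => g (S i)) + 74 * (√(empVar (fun i => g (S i)) * τ) + τ)} := by
  have : {S : Fin N → X | ∀ g ∈ G, ∫ x, g x ∂P ≤
      empMean (fun i => g (S i)) + 74 * (√(empVar (fun i => g (S i)) * τ) + τ)}
      = ⋂ g ∈ G, {S | ∫ x, g x ∂P ≤
        empMean (fun i => g (S i)) + 74 * (√(empVar (fun i => g (S i)) * τ) + τ)} := by
    ext; simp
  rw [this]
  refine MeasurableSet.biInter hG fun g hg => ?_
  have h1 := measurable_empMean_comp (N := N) (hGm g hg) measurable_id
  have h2 := measurable_empVar_comp (N := N) (hGm g hg) measurable_id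
  simp only [id] at h1 h2
  exact measurableSet_le measurable_const (by fun_prop)

theorem measurableSet_exists_ghostExceeds {X : Type*} [MeasurableSpace X] {N : ℕ}
    {G : Set (X → ℝ)} (hG : G.Countable) (hGm : ∀ g ∈ G, Measurable g) (τ : ℝ) :
    MeasurableSet {p : (Fin N → X) × (Fin N → X) |
      ∃ g ∈ G, GhostExceeds τ fun i => (g (p.1 i), g (p.2 i))} := by
  have : {p : (Fin N → X) × (Fin N → X) |
      ∃ g ∈ G, GhostExceeds τ fun i => (g (p.1 i), g (p.2 i))}
      = ⋃ g ∈ G, {p | GhostExceeds τ fun i => (g (p.1 i), g (p.2 i))} := by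
    ext; simp
  rw [this]
  refine MeasurableSet.biUnion hG fun g hg => ?_
  have h1 := measurable_empMean_comp (N := N) (hGm g hg)
    (measurable_fst (α := Fin N → X) (β := Fin N → X))
  have h2 := measurable_empVar_comp (N := N) (hGm g hg)
    (measurable_fst (α := Fin N → X) (β := Fin N → X))
  have h3 := measurable_empMean_comp (N := N) (hGm g hg)
    (measurable_snd (α := Fin N → X) (β := Fin N → X))
  have h4 := measurable_empVar_comp (N := N) (hGm g hg)
    (measurable_snd (α := Fin N → X) (β := Fin N → X))
  unfold GhostExceeds
  exact measurableSet_le (by fun_prop) (by fun_prop)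

/-! ### The uniform empirical Bernstein bound -/

theorem measure_ghostExceeds_le {X : Type*} [MeasurableSpace X] (P : Measure X)
    [IsProbabilityMeasure P] {H G : Set (X → ℝ)} (hGH : G ⊆ H) (hG : G.Countable)
    (hHm : ∀ h ∈ H, Measurable h) (hH1 : ∀ h ∈ H, ∀ x, h x ∈ Set.Icc (0 : ℝ) 1)
    {N M : ℕ} (hN : 0 < N) (hM : uniformCoverNum (1 / (N : ℝ)) H (2 * N) = (M : ℕ∞))
    {L : ℝ} (hL : 2 ≤ L) (hLN : L / N ≤ 1 / 8) :
    ((Measure.pi fun _ : Fin N => P).prod (Measure.pi fun _ : Fin N => P)).real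
      {p | ∃ g ∈ G, GhostExceeds (L / N) fun i => (g (p.1 i), g (p.2 i))}
      ≤ M * (3 * Real.exp (-L)) := by
  classical
  have hN' : (0 : ℝ) < N := by positivity
  have hmeas := measurableSet_exists_ghostExceeds (N := N) hG
    (fun g hg => hHm g (hGH hg)) (L / N)
  have hmp := measurePreserving_arrowProdEquivProdArrow X X (Fin N) (fun _ => P) fun _ => P
  rw [measureReal_def, ← hmp.measure_preimage hmeas.nullMeasurableSet, ← measureReal_def]
  refine measure_le_of_card_swapPair_le P (hmp.measurable hmeas) fun ω => ?_
  obtain ⟨C, hCM, hCH, hC⟩ := exists_finset_cover_of_uniformCoverNum hM ω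
  let bad (c : Fin N → ℝ × ℝ) := Finset.univ.filter fun ε : Fin N → Bool =>
    ExceedsBernstein (L / N) (swapPair ε c)
  have hsub : ∀ ε : Fin N → Bool, (∃ g ∈ G, GhostExceeds (L / N) fun i =>
      (g (swapPair ε ω i).1, g (swapPair ε ω i).2)) → ε ∈ C.biUnion bad := by
    rintro ε ⟨g, hg, hgE⟩
    -- One cover, chosen for the unswapped ω, serves all ε: a swap permutes the coordinates of g and
    -- of its centre alike.
    obtain ⟨c, hc, hgc⟩ := hC g (hGH hg)
    refine Finset.mem_biUnion.2 ⟨c, hc, Finset.mem_filter.2 ⟨Finset.mem_univ _, ?_⟩⟩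
    refine exceedsBernstein_of_ghostExceeds hN (by positivity) hLN (r := 1 / N) (by positivity) ?_
      (fun i => ?_) hgE
    -- The scale 1/N is at most τ/2 because L ≥ 2.
    · rw [div_div, mul_comm, ← div_div]
      gcongr
      linarith
    · simp only [swapPair]
      split_ifs
      · exact (hgc i).symm
      · exact hgc i
  calc (Nat.card {ε : Fin N → Bool // ∃ g ∈ G, GhostExceeds (L / N) fun i =>
        (g (swapPair ε ω i).1, g (swapPair ε ω i).2)} : ℝ)
      ≤ ((C.biUnion bad).card : ℝ) := by
        rw [Nat.card_eq_fintype_card, Fintype.card_subtype]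
        exact_mod_cast Finset.card_le_card fun ε hε => hsub ε (Finset.mem_filter.1 hε).2
    _ ≤ ∑ c ∈ C, ((bad c).card : ℝ) := by exact_mod_cast Finset.card_biUnion_le
    _ ≤ ∑ c ∈ C, 3 * (2 ^ N * Real.exp (-L)) := by
        refine Finset.sum_le_sum fun c hc => ?_
        obtain ⟨h, hh, rfl⟩ := hCH c hc
        have := card_exceedsBernstein_swapPair_le hN (by linarith) hLN
          (fun i => (h (ω i).1, h (ω i).2)) fun i => ⟨hH1 h hh _, hH1 h hh _⟩
        rwa [Nat.card_eq_fintype_card, Fintype.card_subtype] at this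
    _ ≤ 2 ^ N * (M * (3 * Real.exp (-L))) := by
        rw [Finset.sum_const, nsmul_eq_mul,
          show (2 : ℝ) ^ N * (M * (3 * Real.exp (-L))) = M * (3 * (2 ^ N * Real.exp (-L))) by ring]
        gcongr

theorem one_sub_le_measure_bernstein {X : Type*} [MeasurableSpace X] (P : Measure X)
    [IsProbabilityMeasure P] {H G : Set (X → ℝ)} (hGH : G ⊆ H) (hG : G.Countable)
    (hHm : ∀ h ∈ H, Measurable h) (hH1 : ∀ h ∈ H, ∀ x, h x ∈ Set.Icc (0 : ℝ) 1)
    {N M : ℕ} (hN : 0 < N) (hM : uniformCoverNum (1 / (N : ℝ)) H (2 * N) = (M : ℕ∞))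
    {L : ℝ} (hL : 2 ≤ L) (hLN : L / N ≤ 1 / 8) :
    1 - 6 * M * Real.exp (-L) ≤ (Measure.pi fun _ : Fin N => P).real
      {S | ∀ g ∈ G, ∫ x, g x ∂P ≤ empMean (fun i => g (S i))
        + 74 * (√(empVar (fun i => g (S i)) * (L / N)) + L / N)} := by
  have hN' : (0 : ℝ) < N := by positivity
  have hN16 : 16 ≤ N := by
    rw [div_le_iff₀ hN'] at hLN
    have : (16 : ℝ) ≤ N := by linarith
    exact_mod_cast this
  set π := Measure.pi fun _ : Fin N => P with hπ
  set τ := L / N with hτ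
  have hNτ : 1 / (N : ℝ) ≤ τ := by rw [hτ]; gcongr; linarith
  have hτ0 : 0 ≤ τ := by positivity
  set E := {S : Fin N → X | ∀ g ∈ G, ∫ x, g x ∂P ≤ empMean (fun i => g (S i))
        + 74 * (√(empVar (fun i => g (S i)) * τ) + τ)} with hE
  have hEm : MeasurableSet E :=
    measurableSet_forall_bernstein P hG (fun g hg => hHm g (hGH hg)) τ
  set B := {p : (Fin N → X) × (Fin N → X) |
    ∃ g ∈ G, GhostExceeds τ fun i => (g (p.1 i), g (p.2 i))} with hB
  -- By Fubini: over each S outside E, the slice of B has measure at least 1/2.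
  have hle : (1 / 2 : ENNReal) * π Eᶜ ≤ (π.prod π) B := by
    rw [Measure.prod_apply (measurableSet_exists_ghostExceeds hG (fun g hg => hHm g (hGH hg)) τ)]
    rw [← setLIntegral_const]
    refine le_trans (setLIntegral_mono' hEm.compl fun S hS => ?_) (setLIntegral_le_lintegral _ _)
    simp only [hE, Set.mem_compl_iff, Set.mem_ofPred_eq, not_forall, not_le] at hS
    obtain ⟨g, hg, hlt⟩ := hS
    refine (half_le_measure_integral_le_empMean P (hHm g (hGH hg)) (hH1 g (hGH hg)) hN16).trans
      (measure_mono fun S' hS' => ⟨g, hg, ?_⟩)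
    have h1 : √(empVar (fun i => g (S' i)) / N) ≤ √(empVar (fun i => g (S' i)) * τ) := by
      apply Real.sqrt_le_sqrt
      rw [div_eq_mul_one_div]
      exact mul_le_mul_of_nonneg_left hNτ (empVar_nonneg _)
    have h2 : (7 : ℝ) / N ≤ 7 * τ := by rw [div_eq_mul_one_div]; gcongr
    simp only [Set.mem_ofPred_eq] at hS'
    simp only [GhostExceeds]
    linarith
  have hle' : 1 / 2 * π.real Eᶜ ≤ (π.prod π).real B := by
    have := ENNReal.toReal_mono (measure_ne_top _ _) hle
    simpa [measureReal_def] using this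
  have hBle := measure_ghostExceeds_le P hGH hG hHm hH1 hN hM hL hLN
  rw [probReal_compl_eq_one_sub hEm] at hle'
  linarith

/-- The good event is defined through countably many g to be measurable. The bound survives
pointwise limits: dominated convergence on the left, continuity in the N sampled values on the
right. -/
theorem integral_le_of_forall_pointwise_dense {X : Type*} [MeasurableSpace X] (P : Measure X)
    [IsProbabilityMeasure P] {G : Set (X → ℝ)} (hGm : ∀ g ∈ G, Measurable g)
    (hG1 : ∀ g ∈ G, ∀ x, g x ∈ Set.Icc (0 : ℝ) 1) {N : ℕ} {K τ : ℝ} {S : Fin N → X}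
    (hS : ∀ g ∈ G, ∫ x, g x ∂P ≤ empMean (fun i => g (S i))
      + K * (√(empVar (fun i => g (S i)) * τ) + τ))
    {h : X → ℝ} {g : ℕ → X → ℝ} (hg : ∀ n, g n ∈ G)
    (hlim : ∀ x, Tendsto (fun n => g n x) atTop (𝓝 (h x))) :
    ∫ x, h x ∂P ≤ empMean (fun i => h (S i)) + K * (√(empVar (fun i => h (S i)) * τ) + τ) := by
  have h1 : Tendsto (fun n => ∫ x, g n x ∂P) atTop (𝓝 (∫ x, h x ∂P)) :=
    tendsto_integral_of_dominated_convergence (fun _ => 1)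
      (fun n => (hGm _ (hg n)).aestronglyMeasurable) (integrable_const _)
      (fun n => ae_of_all _ fun x => by
        rw [Real.norm_eq_abs, abs_of_nonneg (hG1 _ (hg n) x).1]; exact (hG1 _ (hg n) x).2)
      (ae_of_all _ hlim)
  have h2 : Tendsto (fun n => fun i => g n (S i)) atTop (𝓝 fun i => h (S i)) :=
    tendsto_pi_nhds.2 fun i => hlim (S i)
  have hc : Continuous fun v : Fin N → ℝ => empMean v + K * (√(empVar v * τ) + τ) := by
    unfold empVar empMean; fun_prop
  exact le_of_tendsto_of_tendsto' h1 ((hc.tendsto _).comp h2) fun n => hS _ (hg n)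

/-- Empirical Bernstein bound, uniform over a pointwise measurable class with finite uniform
covering number. -/
theorem exists_measurableSet_bernstein {X : Type*} [MeasurableSpace X] (P : Measure X)
    [IsProbabilityMeasure P] {H : Set (X → ℝ)} (hH : PointwiseMeasurableClass H)
    (hHm : ∀ h ∈ H, Measurable h) (hH1 : ∀ h ∈ H, ∀ x, h x ∈ Set.Icc (0 : ℝ) 1)
    {N M : ℕ} (hN : 0 < N) (hM : uniformCoverNum (1 / (N : ℝ)) H (2 * N) = (M : ℕ∞))
    {δ : ℝ} (hδ : 0 < δ) (hδ1 : δ < 1) :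
    ∃ E : Set (Fin N → X), MeasurableSet E ∧ 1 - δ ≤ (Measure.pi fun _ : Fin N => P).real E ∧
      ∀ S ∈ E, ∀ h ∈ H, ∫ x, h x ∂P ≤ empMean (fun i => h (S i))
        + 74 * (√(empVar (fun i => h (S i)) * (Real.log (10 * M / δ) / N))
          + Real.log (10 * M / δ) / N) := by
  obtain ⟨x₀⟩ : Nonempty X := P.nonempty_of_neZero
  -- An empty class has M = 0, where `Real.log` returns 0 and L ≥ 2 would fail.
  rcases H.eq_empty_or_nonempty with rfl | hne
  · exact ⟨Set.univ, MeasurableSet.univ, by simp [hδ.le], by simp⟩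
  have hM0 : 1 ≤ M := by
    obtain ⟨C, hCM, -, hC⟩ := exists_finset_cover_of_uniformCoverNum hM fun _ => (x₀, x₀)
    obtain ⟨h, hh⟩ := hne
    obtain ⟨c, hc, -⟩ := hC h hh
    exact (Finset.card_pos.2 ⟨c, hc⟩).trans_le hCM
  have hM1 : (1 : ℝ) ≤ M := by exact_mod_cast hM0
  have hN' : (0 : ℝ) < N := by positivity
  set L := Real.log (10 * M / δ) with hLdef
  have harg : 0 < 10 * M / δ := by positivity
  -- This is where the factor 10 is needed: 10 > e².
  have hL : 2 ≤ L := by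
    rw [hLdef, Real.le_log_iff_exp_le harg]
    have h10 : (10 : ℝ) ≤ 10 * M / δ := by
      rw [le_div_iff₀ hδ]; nlinarith
    have he : Real.exp 2 = Real.exp 1 * Real.exp 1 := by rw [← Real.exp_add]; norm_num
    have := Real.exp_one_lt_d9
    have := Real.exp_pos 1
    nlinarith
  by_cases hLN : L / N ≤ 1 / 8
  · obtain ⟨G, hGH, hGc, hGd⟩ := hH
    have hGm : ∀ g ∈ G, Measurable g := fun g hg => hHm g (hGH hg)
    refine ⟨{S | ∀ g ∈ G, ∫ x, g x ∂P ≤ empMean (fun i => g (S i))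
      + 74 * (√(empVar (fun i => g (S i)) * (L / N)) + L / N)},
      measurableSet_forall_bernstein P hGc hGm _, ?_, ?_⟩
    · refine le_trans ?_ (one_sub_le_measure_bernstein P hGH hGc hHm hH1 hN hM hL hLN)
      have : 6 * M * Real.exp (-L) = 6 / 10 * δ := by
        rw [Real.exp_neg, Real.exp_log harg]
        field_simp
      rw [this]
      linarith
    · intro S hS h hh
      obtain ⟨g, hg, hlim⟩ := hGd h hh
      exact integral_le_of_forall_pointwise_dense P hGm (fun g hg => hH1 g (hGH hg)) hS hg hlim
  -- If L/N > 1/8, the remainder 74 L/N already exceeds 1, so the bound is trivial.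
  · refine ⟨Set.univ, MeasurableSet.univ, by simp [hδ.le], fun S _ h hh => ?_⟩
    have h1 : ∫ x, h x ∂P ≤ 1 := by
      calc ∫ x, h x ∂P ≤ ∫ _, (1 : ℝ) ∂P :=
            integral_mono_of_nonneg (ae_of_all _ fun x => (hH1 h hh x).1) (integrable_const _)
              (ae_of_all _ fun x => (hH1 h hh x).2)
        _ = 1 := by simp
    have h2 := (empMean_mem_Icc hN fun i => hH1 h hh (S i)).1
    have h3 := Real.sqrt_nonneg (empVar (fun i => h (S i)) * (L / N))
    linarith

/-! ### From the induced class to the three risks -/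

theorem risk_le_integral_add {X : Type*} [MeasurableSpace X] (P : Measure X)
    [IsProbabilityMeasure P] {p q : X → ℝ} {ℓ : ℝ → ℝ} {f : X → ℝ}
    (hp : Measurable p) (hp1 : ∀ s, p s ∈ Set.Icc (0 : ℝ) 1)
    (hq : Measurable q) (hq1 : ∀ s, q s ∈ Set.Icc (0 : ℝ) 1)
    (hℓ : Measurable ℓ) (hℓ1 : ∀ t, ℓ t ∈ Set.Icc (0 : ℝ) 1) (hf : Measurable f) :
    risk P p ℓ f ≤ ∫ s, q s * ℓ (f s) ∂P + ∫ s, ‖q s - p s‖ ∂P := by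
  have bound : ∀ {r : X → ℝ}, Measurable r → (∀ s, r s ∈ Set.Icc (0 : ℝ) 1) →
      Integrable (fun s => r s * ℓ (f s)) P := fun hr hr1 =>
    Integrable.of_bound (Measurable.aestronglyMeasurable (by fun_prop)) 1 (ae_of_all _ fun s => by
      rw [Real.norm_eq_abs, abs_of_nonneg (mul_nonneg (hr1 s).1 (hℓ1 _).1)]
      exact mul_le_one₀ (hr1 s).2 (hℓ1 _).1 (hℓ1 _).2)
  have hd : Integrable (fun s => ‖q s - p s‖) P :=
    Integrable.of_bound (Measurable.aestronglyMeasurable (by fun_prop)) 1 (ae_of_all _ fun s => by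
      rw [norm_norm, Real.norm_eq_abs, abs_le]
      constructor <;> linarith [(hp1 s).1, (hp1 s).2, (hq1 s).1, (hq1 s).2])
  rw [risk, ← integral_add (bound hq hq1) hd]
  refine integral_mono (bound hp hp1) ((bound hq hq1).add hd) fun s => ?_
  have h1 := neg_abs_le (q s - p s)
  have h2 : |q s - p s| * ℓ (f s) ≤ |q s - p s| :=
    mul_le_of_le_one_right (abs_nonneg _) (hℓ1 _).2
  have h3 := mul_le_mul_of_nonneg_right h1 (hℓ1 (f s)).1
  simp only [Real.norm_eq_abs]
  linarith

theorem distilledRisk_le_empRisk {X : Type*} {N : ℕ} {q : X → ℝ} {ℓ : ℝ → ℝ}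
    (hq1 : ∀ s, q s ≤ 1) (hℓ0 : ∀ t, 0 ≤ ℓ t) (f : X → ℝ) (S : Fin N → X) :
    distilledRisk q ℓ f S ≤ empRisk ℓ f S := by
  unfold distilledRisk empRisk empMean
  gcongr with i
  exact mul_le_of_le_one_left (hℓ0 _) (hq1 _)

theorem mainTheorem1 :
    ∃ C₁ C₂ : ℝ, 0 < C₁ ∧ 0 < C₂ ∧
      ∀ (X : Type*) [MeasurableSpace X] (P : Measure X) [IsProbabilityMeasure P]
        (pstar phat : X → ℝ) (ℓ : ℝ → ℝ) (F : Set (X → ℝ)),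
        Measurable pstar → (∀ s, pstar s ∈ Set.Icc (0 : ℝ) 1) →
        Measurable phat → (∀ s, phat s ∈ Set.Icc (0 : ℝ) 1) →
        Measurable ℓ → (∀ t, ℓ t ∈ Set.Icc (0 : ℝ) 1) →
        (∀ f ∈ F, Measurable f) →
        PointwiseMeasurableClass (inducedClass phat ℓ F) →
        ∀ N : ℕ, 1 ≤ N → ∀ M : ℕ,
        uniformCoverNum (1 / (N : ℝ)) (inducedClass phat ℓ F) (2 * N) = (M : ℕ∞) →
        ∀ δ : ℝ, 0 < δ → δ < 1 →
        ∃ E : Set (Fin N → X), MeasurableSet E ∧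
          1 - δ ≤ (Measure.pi fun _ : Fin N => P).real E ∧
          ∀ S ∈ E, ∀ f ∈ F,
            risk P pstar ℓ f ≤ distilledRisk phat ℓ f S
              + C₁ * ∫ s, ‖phat s - pstar s‖ ∂P
              + C₂ * (√(lossVar phat ℓ f S * (Real.log (10 * M / δ) / N))
                  + Real.log (10 * M / δ) / N) ∧
            risk P pstar ℓ f ≤ empRisk ℓ f S
              + C₁ * ∫ s, ‖phat s - pstar s‖ ∂P
              + C₂ * (√(lossVar phat ℓ f S * (Real.log (10 * M / δ) / N))
                  + Real.log (10 * M / δ) / N) := by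
  refine ⟨1, 74, one_pos, by norm_num, ?_⟩
  intro X _ P _ pstar phat ℓ F hps hps1 hph hph1 hℓ hℓ1 hF hH N hN M hM δ hδ hδ1
  obtain ⟨E, hEm, hEP, hE⟩ := exists_measurableSet_bernstein P hH
    (by rintro _ ⟨f, hf, rfl⟩; exact hph.mul (hℓ.comp (hF f hf)))
    (by
      rintro _ ⟨f, hf, rfl⟩ x
      exact ⟨mul_nonneg (hph1 x).1 (hℓ1 _).1, mul_le_one₀ (hph1 x).2 (hℓ1 _).1 (hℓ1 _).2⟩)
    hN hM hδ hδ1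
  refine ⟨E, hEm, hEP, fun S hS f hf => ?_⟩
  have h1 := hE S hS _ ⟨f, hf, rfl⟩
  have h2 := risk_le_integral_add P hps hps1 hph hph1 hℓ hℓ1 (hF f hf)
  have h3 := distilledRisk_le_empRisk (fun s => (hph1 s).2) (fun t => (hℓ1 t).1) f S
  have h4 : risk P pstar ℓ f ≤ distilledRisk phat ℓ f S + 1 * ∫ s, ‖phat s - pstar s‖ ∂P
      + 74 * (√(lossVar phat ℓ f S * (Real.log (10 * M / δ) / N))
        + Real.log (10 * M / δ) / N) := by
    simp only [distilledRisk, lossVar]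
    linarith
  exact ⟨h4, by linarith⟩
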